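/- Let $d\ge 1$, and let $\mathcal C^d$ be the set of symmetric positive definite real $d\times d$ matrices. Let $\pi:\mathbb R^d\to[0,\infty)$ be measurable (the target density, not necessarily normalised or integrable), let $\tilde q$ and $q_{\mathrm{fix}}$ be symmetric probability densities on $\mathbb R^d$, let $\theta>0$ and $\beta\in[0,1)$, and let $(\eta_n)_{n\ge 2}\subset(0,1)$ with $\eta_n\to 0$. For $s\in\mathcal C^d$ put $$q_s(z)=(1-\beta)\det(\theta s)^{-1/2}\,\tilde q(\theta^{-1/2}s^{-1/2}z)+\beta\, q_{\mathrm{fix}}(z),$$ and for a symmetric probability density $q$ let $P_q$ be the Metropolis kernel $$P_q(x,A)=\mathbf 1_A(x)\Big[1-\int\min\Big\{1,\frac{\pi(y)}{\pi(x)}\Big\}q(y-x)\,dy\Big]+\int_A\min\Big\{1,\frac{\pi(y)}{\pi(x)}\Big\}q(y-x)\,dy,$$ where the minimum is read as $1$ if $\pi(x)=0$. An adaptive Metropolis (AM) process is a process $(X_n,M_n,S_n)_{n\ge1}$ with values in $\mathbb R^d\times\mathbb R^d\times\mathcal C^d$ on a probability space, with deterministic initial values $X_1=x_1$, $M_1=m_1$,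 $S_1=s_1$, such that for all $n\ge1$, with $\mathcal F_n=\sigma(X_k,M_k,S_k:1\le k\le n)$, $$\mathbb P(X_{n+1}\in A\mid\mathcal F_n)=P_{q_{S_n}}(X_n,A)\quad\text{a.s. for every Borel set } A\subset\mathbb R^d,$$ $$M_{n+1}=(1-\eta_{n+1})M_n+\eta_{n+1}X_{n+1},$$ $$S_{n+1}=(1-\eta_{n+1})S_n+\eta_{n+1}(X_{n+1}-M_n)(X_{n+1}-M_n)^T.$$ Assume the following. 1. (Uniform minorisation) There are a compactly supported probability measure $\nu$ on $\mathbb R^d$, absolutely continuous with respect to Lebesgue measure, constants $\delta>0$ and $c<\infty$, and a measurable map $\xi:\mathbb R^d\times\mathcal C^d\to\mathbb R^d$ such that for all $x\in\mathbb R^d$ and $s\in\mathcal C^d$ one has $\|\xi(x,s)-x\|\le c$ and $P_{q_s}(x,A)\ge\delta\,\nu(A-\xi(x,s))$ for every Borel set $A\subset\mathbb R^d$. 2. $\lim_{n\to\infty}\eta_{n+1}/\eta_n=1$. 3. $\sum_{n\ge2}\eta_n=\infty$ and $\sum_{n\ge2}\eta_n^2<\infty$. Then, almost surely, $$\liminf_{n\to\infty}\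 \inf_{w\in\mathbb R^d,\ \|w\|=1} w^TS_nw>0,$$ where the lower limit is taken in $[0,\infty]$. -/

import Mathlib

open MeasureTheory Filter Topology
open scoped Matrix MatrixOrder

noncomputable section

namespace AdaptiveMetropolis

/-- The state space `ℝ^d` with its Euclidean norm and Borel sigma-algebra. -/
abbrev Vec (d : ℕ) : Type := EuclideanSpace ℝ (Fin d)

/-- The cone `C^d` of (symmetric) positive definite real `d × d` matrices, with the Borel
sigma-algebra inherited from the space of matrices. -/
abbrev PDMat (d : ℕ) : Type := {s : Matrix (Fin d) (Fin d) ℝ // s.PosDef}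

/-- The entrywise (that is, Borel) sigma-algebra on square matrices. -/
instance instMeasurableSpaceMatrix (d : ℕ) : MeasurableSpace (Matrix (Fin d) (Fin d) ℝ) :=
  MeasurableSpace.pi

instance instBorelSpaceMatrix (d : ℕ) : BorelSpace (Matrix (Fin d) (Fin d) ℝ) :=
  inferInstanceAs (BorelSpace (Fin d → Fin d → ℝ))

/-- Symmetric probability densities on `ℝ^d` with respect to Lebesgue measure. -/
structure IsSymmDensity {d : ℕ} (q : Vec d → ℝ) : Prop where
  measurable : Measurable q
  nonneg : ∀ z, 0 ≤ q z
  lintegral_eq_one : ∫⁻ z, ENNReal.ofReal (q z) = 1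
  symm : ∀ z, q (-z) = q z

/-- The Metropolis acceptance probability `min {1, π(y) / π(x)}`, equal to `1` by the usual
convention if `π(x) = 0`. -/
def accept {d : ℕ} (π : Vec d → ℝ) (x y : Vec d) : ℝ :=
  if π x = 0 then 1 else min 1 (π y / π x)

/-- The accepted part `y ↦ min {1, π(y) / π(x)} q(y - x)` of a Metropolis move from `x`. -/
def acceptedDensity {d : ℕ} (π q : Vec d → ℝ) (x y : Vec d) : ENNReal :=
  ENNReal.ofReal (accept π x y * q (y - x))

/-- The Metropolis transition kernel
`P_q(x, A) = 1_A(x) [1 - ∫ min {1, π(y)/π(x)} q(y-x) dy] + ∫_A min {1, π(y)/π(x)} q(y-x) dy`. -/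
def metropolis {d : ℕ} (π q : Vec d → ℝ) (x : Vec d) : Measure (Vec d) :=
  (1 - ∫⁻ y, acceptedDensity π q x y) • Measure.dirac x
    + volume.withDensity (acceptedDensity π q x)

/-- The parameters of the algorithm. -/
structure Model (d : ℕ) where
  /-- the target density; it need not be normalised, nor even integrable -/
  target : Vec d → ℝ
  /-- the template proposal density -/
  template : Vec d → ℝ
  /-- the fixed proposal density -/
  qfix : Vec d → ℝ
  /-- the scaling constant -/
  θ : ℝ
  /-- the mixing constant -/
  β : ℝ
  /-- the adaptation weights `η n`, of which only those with `n ≥ 2` are used -/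
  η : ℕ → ℝ
  /-- the initial position -/
  x₁ : Vec d
  /-- the initial mean -/
  m₁ : Vec d
  /-- the initial covariance -/
  s₁ : PDMat d
  measurable_target : Measurable target
  target_nonneg : ∀ x, 0 ≤ target x
  template_density : IsSymmDensity template
  qfix_density : IsSymmDensity qfix
  θ_pos : 0 < θ
  β_nonneg : 0 ≤ β
  β_lt_one : β < 1
  η_mem : ∀ n, 2 ≤ n → η n ∈ Set.Ioo (0 : ℝ) 1
  η_tendsto : Tendsto η atTop (𝓝 0)

namespace Model

variable {d : ℕ} (A : Model d)

/-- The adaptive proposal density `det(θ s)^{-1/2} q̃(θ^{-1/2} s^{-1/2} z)`. -/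
def adaptiveProposal (s : PDMat d) (z : Vec d) : ℝ :=
  (A.θ • s.1).det ^ (-(1 / 2) : ℝ) *
    A.template (WithLp.toLp 2 (A.θ ^ (-(1 / 2) : ℝ) • ((CFC.sqrt s.1)⁻¹ *ᵥ z.ofLp)))

/-- The mixture proposal density `q_s = (1 - β) q̃_s + β q_fix`. -/
def proposal (s : PDMat d) (z : Vec d) : ℝ :=
  (1 - A.β) * A.adaptiveProposal s z + A.β * A.qfix z

/-- The transition kernel `P_{q_s}(x, ·)`. -/
def kernel (s : PDMat d) (x : Vec d) : Measure (Vec d) :=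
  metropolis A.target (A.proposal s) x

/-- The uniform minorisation assumption on the family of kernels `P_{q_s}`. -/
def UniformMinorisation : Prop :=
  ∃ (ν : Measure (Vec d)) (δ c : ℝ) (ξ : Vec d × PDMat d → Vec d),
    IsProbabilityMeasure ν ∧ (∃ K : Set (Vec d), IsCompact K ∧ ν Kᶜ = 0) ∧ ν ≪ volume ∧
    0 < δ ∧ Measurable ξ ∧
    ∀ (x : Vec d) (s : PDMat d), ‖ξ (x, s) - x‖ ≤ c ∧
      ∀ B : Set (Vec d), MeasurableSet B →
        ENNReal.ofReal δ * ν ((fun b => b - ξ (x, s)) '' B) ≤ A.kernel s x B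

/-- The ratios of consecutive adaptation weights tend to one. -/
def RatioCondition : Prop :=
  Tendsto (fun n => A.η (n + 1) / A.η n) atTop (𝓝 1)

/-- The adaptation weights `(η n)_{n ≥ 2}` are in `ℓ²` but not in `ℓ¹`. -/
def EllCondition : Prop :=
  ¬ Summable (fun n => A.η (n + 2)) ∧ Summable (fun n => A.η (n + 2) ^ 2)

end Model

/-- The natural sigma-algebra `F_n = σ(X_k, M_k, S_k : 1 ≤ k ≤ n)`. -/
abbrev history {d : ℕ} {Ω : Type*} (X M : ℕ → Ω → Vec d) (S : ℕ → Ω → PDMat d) (n : ℕ) :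
    MeasurableSpace Ω :=
  ⨆ k ∈ Set.Icc 1 n, MeasurableSpace.comap (fun ω => (X k ω, M k ω, S k ω)) inferInstance

/-- `(X_n, M_n, S_n)_{n ≥ 1}` is an adaptive Metropolis process with the given parameters.
The values at the index `0` play no role. -/
structure IsProcess {d : ℕ} (A : Model d) {Ω : Type*} [MeasurableSpace Ω] (P : Measure Ω)
    (X M : ℕ → Ω → Vec d) (S : ℕ → Ω → PDMat d) : Prop where
  measurable_X : ∀ n, 1 ≤ n → Measurable (X n)
  measurable_M : ∀ n, 1 ≤ n → Measurable (M n)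
  measurable_S : ∀ n, 1 ≤ n → Measurable (S n)
  init_X : ∀ ω, X 1 ω = A.x₁
  init_M : ∀ ω, M 1 ω = A.m₁
  init_S : ∀ ω, S 1 ω = A.s₁
  /-- `P(X_{n+1} ∈ B | F_n) = P_{q_{S_n}}(X_n, B)` almost surely -/
  step_X : ∀ n, 1 ≤ n → ∀ B : Set (Vec d), MeasurableSet B →
    P[(X (n + 1) ⁻¹' B).indicator (fun _ => (1 : ℝ)) | history X M S n]
      =ᵐ[P] fun ω => (A.kernel (S n ω) (X n ω)).real B
  step_M : ∀ n, 1 ≤ n → ∀ ω,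
    M (n + 1) ω = (1 - A.η (n + 1)) • M n ω + A.η (n + 1) • X (n + 1) ω
  step_S : ∀ n, 1 ≤ n → ∀ ω,
    (S (n + 1) ω).1 = (1 - A.η (n + 1)) • (S n ω).1 + A.η (n + 1) •
      Matrix.vecMulVec (X (n + 1) ω - M n ω).ofLp (X (n + 1) ω - M n ω).ofLp

/-- The infimum of `wᵀ s w` over the Euclidean unit sphere. -/
def sphereInf {d : ℕ} (s : PDMat d) : ℝ :=
  ⨅ w : Metric.sphere (0 : Vec d) 1, w.1.ofLp ⬝ᵥ (s.1 *ᵥ w.1.ofLp)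

end AdaptiveMetropolis

end

/-!
Fix a unit vector `w`, and write `V n = wᵀ S n w` and `y n = w · (X n - M (n - 1))`, so that
`V (n + 1) = (1 - η (n + 1)) V n + η (n + 1) y (n + 1) ^ 2`. The vectors `X n - M (n - 1)` may be
arbitrarily long, and then a bounded random perturbation hardly changes their direction: working
with them directly gives no control that is uniform in `w`. The increments of the chain do not have
this defect, and they are visible in `S`, because of the exact identity
`y (n + 1) - (1 - η n) y n = w · (X (n + 1) - X n)`. Hence two consecutive terms of the recursion
for `V` dominate `(w · (X (n + 1) - X n)) ^ 2`, up to a constant, as soon as consecutive weights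
are comparable; here the ratio condition enters. It follows that `8 V n` dominates the running
average, with the same weights, of the squares `(w · (X (k + 1) - X k)) ^ 2` cut off at
`‖X (k + 1) - X k‖ ≤ R` (`runningAverage_le_of_recursion`, `IsProcess.runningAverage_cutSq_le`).

Given the past, `X (n + 1) - X n` has a law which is at least `δ` times a translate of `ν`, by a
vector of norm at most `c`. So for suitable `R` the cut-off squares have conditional mean at least
`δ` times the variance of `w · U` for `U ∼ ν`, and this is positive since `ν` does not charge
hyperplanes (`Model.UniformMinorisation.exists_le_integral_cutSq`, `IsProcess.le_condExp_cutSq`).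
For bounded variables and weights in `ℓ² \ ℓ¹`, running averages are asymptotically no smaller than
the conditional means (`ae_eventually_lt_runningAverage`): the weighted sums of the centred
variables are an `L²`-bounded martingale, hence converge almost surely. Finally, the cut-off squares
are uniformly Lipschitz in `w`, so that compactness of the sphere makes the lower bound uniform
(`IsProcess.exists_le_runningAverage_cutSq`).
-/

namespace AdaptiveMetropolis

/-! ### Weighted running averages -/

/-- The running average `t (n + 1) = (1 - η n) t n + η n g n` of the sequence `g` with weights `η`,
started at `0`. -/
def runningAverage (η g : ℕ → ℝ) : ℕ → ℝ
  | 0 => 0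
  | n + 1 => (1 - η n) * runningAverage η g n + η n * g n

theorem abs_runningAverage_sub_le {η g g' : ℕ → ℝ} {C : ℝ} (hη : ∀ n, η n ∈ Set.Icc (0 : ℝ) 1)
    (hC : 0 ≤ C) (h : ∀ n, |g n - g' n| ≤ C) (n : ℕ) :
    |runningAverage η g n - runningAverage η g' n| ≤ C := by
  induction n with
  | zero => simpa [runningAverage] using hC
  | succ n ih =>
    obtain ⟨h0, h1⟩ := hη n
    have e : runningAverage η g (n + 1) - runningAverage η g' (n + 1)
        = (1 - η n) * (runningAverage η g n - runningAverage η g' n) + η n * (g n - g' n) := by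
      simp only [runningAverage]; ring
    rw [e]
    calc _ ≤ |(1 - η n) * (runningAverage η g n - runningAverage η g' n)|
          + |η n * (g n - g' n)| := abs_add_le _ _
      _ = (1 - η n) * |runningAverage η g n - runningAverage η g' n| + η n * |g n - g' n| := by
          rw [abs_mul, abs_mul, abs_of_nonneg h0, abs_of_nonneg (sub_nonneg.2 h1)]
      _ ≤ (1 - η n) * C + η n * C := by
          have := h n
          have := sub_nonneg.2 h1
          gcongr
      _ = C := by ring

theorem tendsto_prod_one_sub_of_not_summable {η : ℕ → ℝ} (hη : ∀ n, η n ∈ Set.Icc (0 : ℝ) 1)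
    (hs : ¬ Summable η) :
    Tendsto (fun n => ∏ k ∈ Finset.range n, (1 - η k)) atTop (𝓝 0) := by
  have h := (not_summable_iff_tendsto_nat_atTop_of_nonneg (fun n => (hη n).1)).1 hs
  have h' := Real.tendsto_exp_neg_atTop_nhds_zero.comp h
  refine squeeze_zero (fun n => Finset.prod_nonneg fun k _ => sub_nonneg.2 (hη k).2)
    (fun n => ?_) h'
  simp only [Function.comp, ← Finset.sum_neg_distrib, Real.exp_sum]
  exact Finset.prod_le_prod (fun k _ => sub_nonneg.2 (hη k).2)
    fun k _ => Real.one_sub_le_exp_neg _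

/-- A recursion with non-summable weights forgets its initial value, and it is insensitive to
additive perturbations that are the increments of a convergent sequence. -/
theorem eventually_lt_of_recursion {η t h m : ℕ → ℝ} {a b l : ℝ}
    (hη : ∀ n, η n ∈ Set.Icc (0 : ℝ) 1) (hs : ¬ Summable η) (hm : Tendsto m atTop (𝓝 l))
    (ha : ∀ n, a ≤ h n)
    (ht : ∀ n, t (n + 1) = (1 - η n) * t n + η n * h n + (m (n + 1) - m n)) (hb : b < a) :
    ∀ᶠ n in atTop, b < t n := by
  set ε := (a - b) / 3 with hε
  have hεpos : 0 < ε := by rw [hε]; linarith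
  obtain ⟨N, hN⟩ := eventually_atTop.1
    ((hm.eventually (lt_mem_nhds (show l - ε < l by linarith))).and
      (hm.eventually (gt_mem_nhds (show l < l + ε by linarith))))
  -- The shifted sequence `t - m` satisfies the unperturbed recursion with input `h - m`.
  set c := a - l - ε with hc
  have hprod := tendsto_prod_one_sub_of_not_summable (η := fun k => η (k + N))
    (fun n => hη _) (fun H => hs ((summable_nat_add_iff N).1 H))
  have key : ∀ k, -((∏ j ∈ Finset.range k, (1 - η (j + N))) * |t N - m N - c|)
      ≤ t (k + N) - m (k + N) - c := by
    intro k
    induction k with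
    | zero => simpa using neg_abs_le (t N - m N - c)
    | succ k ih =>
      rw [Finset.prod_range_succ, show k + 1 + N = k + N + 1 by ring, ht]
      have h1 := sub_nonneg.2 (hη (k + N)).2
      have h2 := mul_le_mul_of_nonneg_left ih h1
      have h3 : 0 ≤ η (k + N) * (h (k + N) - m (k + N) - c) := by
        refine mul_nonneg (hη _).1 ?_
        have := (hN (k + N) (by omega)).2
        have := ha (k + N)
        rw [hc]; linarith
      nlinarith
  have hlim : Tendsto (fun k => (∏ j ∈ Finset.range k, (1 - η (j + N))) * |t N - m N - c|) atTop
      (𝓝 0) := by simpa using hprod.mul_const |t N - m N - c|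
  obtain ⟨K, hK⟩ := eventually_atTop.1 (hlim.eventually (gt_mem_nhds hεpos))
  refine eventually_atTop.2 ⟨K + N, fun n hn => ?_⟩
  obtain ⟨k, rfl⟩ : ∃ k, n = k + N := ⟨n - N, by omega⟩
  have h1 := key k
  have h2 := hK k (by omega)
  have h3 := (hN (k + N) (by omega)).1
  rw [hc] at h1
  have : 3 * ε = a - b := by rw [hε]; ring
  linarith

/-! ### A strong law for weighted running averages -/

section Martingale

variable {Ω : Type*} {mΩ : MeasurableSpace Ω} {P : Measure Ω} [IsProbabilityMeasure P]

/-- The weighted sums of the centred variables form a martingale, which is bounded in `L²` because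
the weights are square summable. -/
theorem ae_exists_tendsto_sum_sub_condExp (ℱ : Filtration ℕ mΩ) {g : ℕ → Ω → ℝ} {η : ℕ → ℝ}
    {B : ℝ} (hg : ∀ n, StronglyMeasurable[ℱ (n + 1)] (g n)) (hB : ∀ n ω, |g n ω| ≤ B)
    (hη : Summable fun n => η n ^ 2) :
    ∀ᵐ ω ∂P, ∃ l, Tendsto
      (fun n => ∑ k ∈ Finset.range n, η k * (g k ω - (P[g k | ℱ k]) ω)) atTop (𝓝 l) := by
  have hB0 : 0 ≤ B := by
    obtain ⟨ω⟩ : Nonempty Ω := nonempty_of_isProbabilityMeasure P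
    exact (abs_nonneg _).trans (hB 0 ω)
  set Δ : ℕ → Ω → ℝ := fun k => g k - P[g k | ℱ k] with hΔ
  set f : ℕ → Ω → ℝ := fun n => ∑ k ∈ Finset.range n, η k • Δ k with hf
  have hgL : ∀ k, MemLp (g k) 2 P := fun k =>
    MemLp.of_bound ((hg k).mono (ℱ.le _)).aestronglyMeasurable B (ae_of_all _ (hB k))
  have hΔL : ∀ k, MemLp (Δ k) 2 P := fun k => (hgL k).sub (MemLp.condExp one_le_two (hgL k))
  have hfL : ∀ n, MemLp (f n) 2 P := fun n =>
    memLp_finsetSum' _ fun k _ => (hΔL k).const_smul _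
  have hΔm : ∀ k, StronglyMeasurable[ℱ (k + 1)] (Δ k) := fun k =>
    (hg k).sub (stronglyMeasurable_condExp.mono (ℱ.mono k.le_succ))
  have hfm : ∀ n, StronglyMeasurable[ℱ n] (f n) := fun n =>
    Finset.stronglyMeasurable_sum _ fun k hk =>
      ((hΔm k).mono (ℱ.mono (Nat.succ_le_of_lt (Finset.mem_range.1 hk)))).const_smul (η k)
  have hfsucc : ∀ n, f (n + 1) = f n + η n • Δ n := fun n => Finset.sum_range_succ _ _
  have hΔ0 : ∀ k, P[Δ k | ℱ k] =ᵐ[P] 0 := fun k => by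
    have h1 := condExp_sub ((hgL k).integrable one_le_two)
      (integrable_condExp (m := ℱ k) (μ := P) (f := g k)) (ℱ k)
    rw [condExp_of_stronglyMeasurable (ℱ.le k) stronglyMeasurable_condExp integrable_condExp]
      at h1
    simpa [hΔ] using h1
  have hmart : Martingale f ℱ P := by
    refine martingale_of_condExp_sub_eq_zero_nat hfm (fun n => (hfL n).integrable one_le_two)
      fun n => ?_
    rw [hfsucc, add_sub_cancel_left]
    refine (condExp_smul (η n) (Δ n) (ℱ n)).trans ?_
    filter_upwards [hΔ0 n] with ω hω
    simp [hω]
  have hΔB : ∀ k, ∫ ω, Δ k ω ^ 2 ∂P ≤ (2 * B) ^ 2 := fun k => by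
    have hb := ae_bdd_abs_condExp_of_ae_bdd_abs (m := ℱ k) (R := B) (ae_of_all P (hB k))
    calc ∫ ω, Δ k ω ^ 2 ∂P ≤ ∫ _, (2 * B) ^ 2 ∂P := by
          refine integral_mono_ae (hΔL k).integrable_sq (integrable_const _) ?_
          filter_upwards [hb] with ω hω
          refine sq_le_sq.2 ?_
          rw [abs_of_nonneg (show 0 ≤ 2 * B by linarith)]
          have h1 := abs_sub (g k ω) ((P[g k | ℱ k]) ω)
          have h2 := hB k ω
          have h3 : |(P[g k | ℱ k]) ω| ≤ B := hω
          simp only [hΔ, Pi.sub_apply]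
          linarith
      _ = (2 * B) ^ 2 := by simp
  have hcross : ∀ n, ∫ ω, f n ω * Δ n ω ∂P = 0 := fun n => by
    have hi : Integrable (f n * Δ n) P := (hfL n).integrable_mul (hΔL n)
    have h1 := condExp_mul_of_stronglyMeasurable_left (hfm n) hi ((hΔL n).integrable one_le_two)
    calc ∫ ω, f n ω * Δ n ω ∂P = ∫ ω, (P[f n * Δ n | ℱ n]) ω ∂P :=
          (integral_condExp (ℱ.le n)).symm
      _ = ∫ _, (0 : ℝ) ∂P := by
          refine integral_congr_ae ?_
          filter_upwards [h1, hΔ0 n] with ω h1 h2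
          rw [h1, Pi.mul_apply, h2]
          simp
      _ = 0 := by simp
  have hL2 : ∀ n, ∫ ω, f n ω ^ 2 ∂P ≤ (2 * B) ^ 2 * ∑ k ∈ Finset.range n, η k ^ 2 := fun n => by
    induction n with
    | zero => simp [hf]
    | succ n ih =>
      have e : ∀ ω, f (n + 1) ω ^ 2
          = f n ω ^ 2 + (2 * η n) * (f n ω * Δ n ω) + η n ^ 2 * Δ n ω ^ 2 := fun ω => by
        rw [hfsucc]; simp only [Pi.add_apply, Pi.smul_apply, smul_eq_mul]; ring
      have i1 := (hfL n).integrable_sq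
      have i2 : Integrable (fun ω => f n ω * Δ n ω) P := (hfL n).integrable_mul (hΔL n)
      have i3 := (hΔL n).integrable_sq
      have i12 : Integrable (fun ω => f n ω ^ 2 + (2 * η n) * (f n ω * Δ n ω)) P :=
        i1.add (i2.const_mul _)
      simp_rw [e]
      rw [integral_add i12 (i3.const_mul _), integral_add i1 (i2.const_mul _),
        integral_const_mul, integral_const_mul, hcross, Finset.sum_range_succ]
      nlinarith [mul_le_mul_of_nonneg_left (hΔB n) (sq_nonneg (η n))]
  set C := (2 * B) ^ 2 * ∑' k, η k ^ 2 with hC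
  have hbdd : ∀ n, eLpNorm (f n) 1 P ≤ ((1 + C).toNNReal : ENNReal) := fun n => by
    have i0 := (hfL n).integrable one_le_two
    have i1 := (hfL n).integrable_sq
    rw [eLpNorm_one_eq_lintegral_enorm, ← ofReal_integral_norm_eq_lintegral_enorm i0]
    refine ENNReal.ofReal_le_ofReal ?_
    calc ∫ ω, ‖f n ω‖ ∂P ≤ ∫ ω, (1 + f n ω ^ 2) ∂P := by
          refine integral_mono i0.norm ((integrable_const _).add i1) fun ω => ?_
          rw [Real.norm_eq_abs]
          nlinarith [sq_abs (f n ω), sq_nonneg (|f n ω| - 1), abs_nonneg (f n ω)]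
      _ = 1 + ∫ ω, f n ω ^ 2 ∂P := by
          rw [integral_add (integrable_const _) i1]; simp
      _ ≤ 1 + C := by
          have := hη.sum_le_tsum (Finset.range n) fun k _ => sq_nonneg (η k)
          have h2 := hL2 n
          have := mul_le_mul_of_nonneg_left this (sq_nonneg (2 * B))
          linarith
  filter_upwards [hmart.submartingale.ae_tendsto_limitProcess hbdd] with ω hω
  refine ⟨_, hω.congr fun n => ?_⟩
  simp [hf, hΔ, Finset.sum_apply]

/-- If the conditional means of a bounded process stay above `a`, then so, asymptotically, do its
running averages with weights in `ℓ² \ ℓ¹`. -/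
theorem ae_eventually_lt_runningAverage (ℱ : Filtration ℕ mΩ) {g : ℕ → Ω → ℝ} {η : ℕ → ℝ}
    {a b B : ℝ} (hg : ∀ n, StronglyMeasurable[ℱ (n + 1)] (g n)) (hB : ∀ n ω, |g n ω| ≤ B)
    (hη : ∀ n, η n ∈ Set.Icc (0 : ℝ) 1) (hη1 : ¬ Summable η) (hη2 : Summable fun n => η n ^ 2)
    (ha : ∀ n, ∀ᵐ ω ∂P, a ≤ (P[g n | ℱ n]) ω) (hb : b < a) :
    ∀ᵐ ω ∂P, ∀ᶠ n in atTop, b < runningAverage η (fun k => g k ω) n := by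
  filter_upwards [ae_exists_tendsto_sum_sub_condExp ℱ hg hB hη2, ae_all_iff.2 ha] with ω hω haω
  obtain ⟨l, hl⟩ := hω
  refine eventually_lt_of_recursion hη hη1 hl haω (fun n => ?_) hb
  rw [Finset.sum_range_succ, runningAverage]
  ring

end Martingale

/-! ### Conditional expectations from a transition mechanism -/

section Conditional

variable {Ω E : Type*} {m mΩ : MeasurableSpace Ω} {P : Measure Ω} [IsProbabilityMeasure P]
  [MeasurableSpace E] [StandardBorelSpace E] [Nonempty E]

/-- Finite measures that give the conditional probabilities of each fixed event almost surely
agree almost surely with the regular conditional distribution: only countably many events have to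
be compared. Conditioning on `m` is conditioning on the identity map into `Ω` with the σ-algebra
`m`, so that `Ω` need not be standard Borel. -/
theorem ae_condDistrib_id_eq (hm : m ≤ mΩ) {Y : Ω → E} (hY : Measurable Y) {κ : Ω → Measure E}
    [∀ ω, IsFiniteMeasure (κ ω)]
    (h : ∀ B, MeasurableSet B →
      P[(Y ⁻¹' B).indicator (fun _ => (1 : ℝ)) | m] =ᵐ[P] fun ω => (κ ω).real B) :
    ∀ᵐ ω ∂P, @ProbabilityTheory.condDistrib Ω Ω E _ _ _ mΩ m Y id P _ ω = κ ω := by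
  have hid : @Measurable Ω Ω mΩ m id := measurable_id'' hm
  have key : ∀ B, MeasurableSet B →
      ∀ᵐ ω ∂P, @ProbabilityTheory.condDistrib Ω Ω E _ _ _ mΩ m Y id P _ ω B = κ ω B := by
    intro B hB
    have h1 := ProbabilityTheory.condDistrib_ae_eq_condExp (mβ := m) (μ := P) hid hY hB
    rw [MeasurableSpace.comap_id] at h1
    filter_upwards [h1, h B hB] with ω h1 h2
    have h3 := h1.trans h2
    rwa [measureReal_def, measureReal_def,
      ENNReal.toReal_eq_toReal_iff' (measure_ne_top _ _) (measure_ne_top _ _)] at h3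
  set 𝒜 := generateSetAlgebra (MeasurableSpace.countableGeneratingSet E) with h𝒜
  have hgen : MeasurableSpace.generateFrom 𝒜 = ‹MeasurableSpace E› := by
    rw [h𝒜, generateFrom_generateSetAlgebra_eq,
      MeasurableSpace.generateFrom_countableGeneratingSet]
  have hc : 𝒜.Countable :=
    countable_generateSetAlgebra (MeasurableSpace.countable_countableGeneratingSet)
  have hall := (ae_ball_iff hc).2 fun B hB =>
    key B (hgen ▸ MeasurableSpace.measurableSet_generateFrom hB)
  filter_upwards [hall, key Set.univ MeasurableSet.univ] with ω h1 h2
  exact ext_of_generate_finite 𝒜 hgen.symm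
    (isSetAlgebra_generateSetAlgebra.isSetRing.isSetSemiring.isPiSystem) h1 h2

/-- Conditional probabilities that are known event by event determine the conditional expectations
of functions of both the past and the next state. -/
theorem condExp_eq_integral_of_transition (hm : m ≤ mΩ) {Y : Ω → E} (hY : Measurable Y)
    {κ : Ω → Measure E} [∀ ω, IsFiniteMeasure (κ ω)]
    (h : ∀ B, MeasurableSet B →
      P[(Y ⁻¹' B).indicator (fun _ => (1 : ℝ)) | m] =ᵐ[P] fun ω => (κ ω).real B)
    {F : Type*} [MeasurableSpace F] {X : Ω → F} (hX : Measurable[m] X) {f : F × E → ℝ}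
    (hf : Measurable f) (hfi : Integrable (fun ω => f (X ω, Y ω)) P) :
    P[fun ω => f (X ω, Y ω) | m] =ᵐ[P] fun ω => ∫ y, f (X ω, y) ∂κ ω := by
  have hid : @Measurable Ω Ω mΩ m id := measurable_id'' hm
  have hXf : Measurable[m.prod inferInstance] fun p : Ω × E => f (X p.1, p.2) :=
    hf.comp ((hX.comp (@measurable_fst Ω E m _)).prodMk (@measurable_snd Ω E m _))
  have h1 := ProbabilityTheory.condExp_prod_ae_eq_integral_condDistrib (mβ := m) (μ := P) hid
    hY.aemeasurable (f := fun p : Ω × E => f (X p.1, p.2)) hXf.stronglyMeasurable hfi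
  rw [MeasurableSpace.comap_id] at h1
  filter_upwards [h1, ae_condDistrib_id_eq hm hY h] with ω h1 h2
  rw [← h2]
  exact h1

end Conditional

/-! ### The Metropolis kernels -/

section Kernel

variable {d : ℕ}

theorem accept_le_one (π : Vec d → ℝ) (x y : Vec d) : accept π x y ≤ 1 := by
  unfold accept
  split_ifs
  · exact le_rfl
  · exact min_le_left _ _

theorem metropolis_univ_lt_top {π q : Vec d → ℝ} (hq : ∀ z, 0 ≤ q z)
    (hqi : ∫⁻ z, ENNReal.ofReal (q z) < ⊤) (x : Vec d) : metropolis π q x Set.univ < ⊤ := by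
  have h1 : ∫⁻ y, acceptedDensity π q x y < ⊤ := by
    refine lt_of_le_of_lt (lintegral_mono fun y => ?_)
      ((lintegral_sub_right_eq_self (fun z => ENNReal.ofReal (q z)) x).trans_lt hqi)
    exact ENNReal.ofReal_le_ofReal (mul_le_of_le_one_left (hq _) (accept_le_one _ _ _))
  simp only [metropolis, Measure.coe_add, Pi.add_apply, Measure.smul_apply, measure_univ,
    withDensity_apply _ MeasurableSet.univ, Measure.restrict_univ, smul_eq_mul, mul_one]
  exact ENNReal.add_lt_top.2 ⟨tsub_le_self.trans_lt ENNReal.one_lt_top, h1⟩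

namespace Model

variable (A : Model d)

theorem adaptiveProposal_nonneg (s : PDMat d) (z : Vec d) : 0 ≤ A.adaptiveProposal s z :=
  mul_nonneg (Real.rpow_nonneg (s.2.smul A.θ_pos).det_pos.le _) (A.template_density.nonneg _)

theorem proposal_nonneg (s : PDMat d) (z : Vec d) : 0 ≤ A.proposal s z :=
  add_nonneg (mul_nonneg (sub_nonneg.2 A.β_lt_one.le) (A.adaptiveProposal_nonneg s z))
    (mul_nonneg A.β_nonneg (A.qfix_density.nonneg z))

theorem isUnit_det_inv_sqrt (s : PDMat d) : IsUnit (CFC.sqrt s.1)⁻¹.det := by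
  rw [Matrix.isUnit_nonsing_inv_det_iff]
  have h := congrArg Matrix.det (CFC.sqrt_mul_sqrt_self s.1 s.2.posSemidef.nonneg)
  rw [Matrix.det_mul] at h
  refine isUnit_iff_ne_zero.2 fun h0 => s.2.det_pos.ne' ?_
  rw [← h, h0, zero_mul]

theorem lintegral_adaptiveProposal_lt_top (s : PDMat d) :
    ∫⁻ z, ENNReal.ofReal (A.adaptiveProposal s z) < ⊤ := by
  set L : Vec d →ₗ[ℝ] Vec d :=
    A.θ ^ (-(1 / 2) : ℝ) • Matrix.toLpLin 2 2 (CFC.sqrt s.1)⁻¹ with hL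
  have hdet : LinearMap.det L ≠ 0 := by
    rw [hL, LinearMap.det_smul]
    refine mul_ne_zero (pow_ne_zero _ (Real.rpow_pos_of_pos A.θ_pos _).ne') ?_
    simpa using (isUnit_det_inv_sqrt s).ne_zero
  have hLm : Measurable L := (LinearMap.continuous_of_finiteDimensional L).measurable
  have hdet' : 0 ≤ (A.θ • s.1).det ^ (-(1 / 2) : ℝ) :=
    Real.rpow_nonneg (s.2.smul A.θ_pos).det_pos.le _
  have e : ∀ z, ENNReal.ofReal (A.adaptiveProposal s z)
      = ENNReal.ofReal ((A.θ • s.1).det ^ (-(1 / 2) : ℝ)) * ENNReal.ofReal (A.template (L z)) :=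
    fun z => ENNReal.ofReal_mul hdet'
  have ht : Measurable fun z => ENNReal.ofReal (A.template z) :=
    A.template_density.measurable.ennreal_ofReal
  simp_rw [e]
  rw [lintegral_const_mul' _ _ ENNReal.ofReal_ne_top, ← lintegral_map ht hLm,
    Measure.map_linearMap_addHaar_eq_smul_addHaar _ hdet, lintegral_smul_measure,
    A.template_density.lintegral_eq_one]
  simp [ENNReal.mul_lt_top]

theorem lintegral_proposal_lt_top (s : PDMat d) :
    ∫⁻ z, ENNReal.ofReal (A.proposal s z) < ⊤ := by
  have e : ∀ z, ENNReal.ofReal (A.proposal s z)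
      = ENNReal.ofReal (1 - A.β) * ENNReal.ofReal (A.adaptiveProposal s z)
        + ENNReal.ofReal A.β * ENNReal.ofReal (A.qfix z) := fun z => by
    have hβ := sub_nonneg.2 A.β_lt_one.le
    rw [proposal, ENNReal.ofReal_add (mul_nonneg hβ (A.adaptiveProposal_nonneg s z))
      (mul_nonneg A.β_nonneg (A.qfix_density.nonneg z)), ENNReal.ofReal_mul hβ,
      ENNReal.ofReal_mul A.β_nonneg]
  have hq : Measurable fun z => ENNReal.ofReal (A.qfix z) :=
    A.qfix_density.measurable.ennreal_ofReal
  simp_rw [e]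
  rw [lintegral_add_right _ (hq.const_mul _), lintegral_const_mul' _ _ ENNReal.ofReal_ne_top,
    lintegral_const_mul' _ _ ENNReal.ofReal_ne_top, A.qfix_density.lintegral_eq_one]
  exact ENNReal.add_lt_top.2 ⟨ENNReal.mul_lt_top ENNReal.ofReal_lt_top
    (A.lintegral_adaptiveProposal_lt_top s), by simp⟩

/-- Finiteness rests on the change of variables in `lintegral_adaptiveProposal_lt_top`; without it
the real-valued masses of the kernel could be junk. -/
instance isFiniteMeasure_kernel (s : PDMat d) (x : Vec d) : IsFiniteMeasure (A.kernel s x) :=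
  ⟨metropolis_univ_lt_top (A.proposal_nonneg s) (A.lintegral_proposal_lt_top s) x⟩

end Model

end Kernel

/-! ### Nondegeneracy of bounded increments -/

section Increments

variable {d : ℕ}

/-- A law on `ℝ^d` that does not charge hyperplanes is nondegenerate in every direction. -/
theorem variance_inner_pos {ν : Measure (Vec d)} [IsProbabilityMeasure ν] (hν : ν ≪ volume)
    {w : Vec d} (hw : w ≠ 0) (hL : MemLp (fun u => inner ℝ w u) 2 ν) :
    0 < ProbabilityTheory.variance (fun u => inner ℝ w u) ν := by
  refine lt_of_le_of_ne (ProbabilityTheory.variance_nonneg _ _) fun h0 => ?_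
  have h1 : ProbabilityTheory.evariance (fun u => inner ℝ w u) ν = 0 := by
    rw [← hL.ofReal_variance_eq, ← h0, ENNReal.ofReal_zero]
  rw [ProbabilityTheory.evariance_eq_zero_iff hL.1.aemeasurable] at h1
  set b := ∫ u, inner ℝ w u ∂ν
  have h2 : volume {u : Vec d | inner ℝ w u = b} = 0 := by
    set s : AffineSubspace ℝ (Vec d) :=
      (AffineSubspace.mk' b (⊥ : Submodule ℝ ℝ)).comap (innerₛₗ ℝ w).toAffineMap with hs
    have hmem : ∀ u, u ∈ s ↔ inner ℝ w u = b := fun u => by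
      simp [hs, AffineSubspace.mem_comap, AffineSubspace.mem_mk', sub_eq_zero]
    have hne : s ≠ ⊤ := fun htop => by
      have m0 : (0 : Vec d) ∈ s := htop ▸ AffineSubspace.mem_top _ _ _
      have m1 : w ∈ s := htop ▸ AffineSubspace.mem_top _ _ _
      rw [hmem, inner_zero_right] at m0
      rw [hmem, ← m0, inner_self_eq_zero] at m1
      exact hw m1
    have := Measure.addHaar_affineSubspace volume s hne
    convert this using 2
    ext u
    exact (hmem u).symm
  have h3 : ∀ᵐ u ∂ν, inner ℝ w u ≠ b := by
    rw [ae_iff]; simpa using hν h2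
  obtain ⟨u, hu, hu'⟩ := (h1.and h3).exists
  exact hu' hu

/-- The squared component in direction `w` of the increment from `x` to `y`, replaced by `0` if the
increment is longer than `R`. -/
noncomputable def cutSq (R : ℝ) (w x y : Vec d) : ℝ :=
  if ‖y - x‖ ≤ R then inner ℝ w (y - x) ^ 2 else 0

theorem cutSq_nonneg (R : ℝ) (w x y : Vec d) : 0 ≤ cutSq R w x y := by
  unfold cutSq; split_ifs <;> positivity

theorem cutSq_le (R : ℝ) (w x y : Vec d) : cutSq R w x y ≤ inner ℝ w (y - x) ^ 2 := by
  unfold cutSq; split_ifs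
  · exact le_rfl
  · positivity

theorem abs_cutSq_sub_le {R : ℝ} (hR : 0 ≤ R) {w v : Vec d} (hw : ‖w‖ = 1) (hv : ‖v‖ = 1)
    (x y : Vec d) : |cutSq R w x y - cutSq R v x y| ≤ 2 * R ^ 2 * ‖w - v‖ := by
  unfold cutSq
  split_ifs with h
  · have e : inner ℝ w (y - x) ^ 2 - inner ℝ v (y - x) ^ 2
        = inner ℝ (w + v) (y - x) * inner ℝ (w - v) (y - x) := by
      rw [inner_add_left, inner_sub_left]; ring
    rw [e, abs_mul]
    calc _ ≤ (‖w + v‖ * ‖y - x‖) * (‖w - v‖ * ‖y - x‖) := by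
          gcongr <;> exact abs_real_inner_le_norm _ _
      _ ≤ (2 * R) * (‖w - v‖ * R) := by
          have : ‖w + v‖ ≤ 2 := (norm_add_le _ _).trans (by rw [hw, hv]; norm_num)
          gcongr
      _ = _ := by ring
  · simp; positivity

theorem cutSq_le_sq {R : ℝ} {w : Vec d} (hw : ‖w‖ = 1) (x y : Vec d) : cutSq R w x y ≤ R ^ 2 := by
  unfold cutSq
  split_ifs with h
  · refine sq_le_sq.2 ((abs_real_inner_le_norm _ _).trans ?_)
    rw [hw, one_mul]
    exact h.trans (le_abs_self R)
  · positivity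

theorem measurable_cutSq_comp {α : Type*} [MeasurableSpace α] (R : ℝ) (w : Vec d)
    {f g : α → Vec d} (hf : Measurable f) (hg : Measurable g) :
    Measurable fun ω => cutSq R w (f ω) (g ω) := by
  have h : Measurable fun ω => g ω - f ω := hg.sub hf
  exact Measurable.ite (measurableSet_le h.norm measurable_const)
    ((h.const_inner).pow_const 2) measurable_const

theorem smul_map_add_const_le {μ ν : Measure (Vec d)} {r : ENNReal} {z : Vec d}
    (h : ∀ B, MeasurableSet B → r * ν ((fun b => b - z) '' B) ≤ μ B) :
    r • ν.map (fun u => u + z) ≤ μ := by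
  refine Measure.le_iff.2 fun B hB => ?_
  have e : (fun u : Vec d => u + z) ⁻¹' B = (fun b => b - z) '' B := by
    ext u
    constructor
    · exact fun hu => ⟨u + z, hu, by simp⟩
    · rintro ⟨b, hb, rfl⟩
      simpa using hb
  rw [Measure.smul_apply, smul_eq_mul, Measure.map_apply (measurable_add_const z) hB, e]
  exact h B hB

/-- The variance of `ν` does not see the unknown centre `z` of the minorising measure. -/
theorem mul_variance_inner_le_integral_cutSq {μ ν : Measure (Vec d)} [IsFiniteMeasure μ]
    [IsProbabilityMeasure ν] {δ c r : ℝ} (hδ : 0 ≤ δ) (hae : ∀ᵐ u ∂ν, ‖u‖ ≤ r) {w x z : Vec d}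
    (hw : ‖w‖ = 1) (hz : ‖z - x‖ ≤ c)
    (h : ∀ B, MeasurableSet B → ENNReal.ofReal δ * ν ((fun b => b - z) '' B) ≤ μ B) :
    δ * ProbabilityTheory.variance (fun u => inner ℝ w u) ν ≤ ∫ y, cutSq (c + r) w x y ∂μ := by
  have hmeas : Measurable fun u : Vec d => inner ℝ w u := measurable_id.const_inner
  have hsh : Measurable fun u : Vec d => u + z := measurable_add_const z
  have hcm : Measurable fun y => cutSq (c + r) w x y :=
    measurable_cutSq_comp (c + r) w measurable_const measurable_id
  calc δ * ProbabilityTheory.variance (fun u => inner ℝ w u) ν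
      = δ * ProbabilityTheory.variance (fun u => inner ℝ w u + inner ℝ w (z - x)) ν := by
        rw [ProbabilityTheory.variance_add_const hmeas.aestronglyMeasurable]
    _ ≤ δ * ∫ u, (inner ℝ w u + inner ℝ w (z - x)) ^ 2 ∂ν :=
        mul_le_mul_of_nonneg_left (ProbabilityTheory.variance_le_expectation_sq
          (hmeas.add_const _).aestronglyMeasurable) hδ
    _ = δ * ∫ u, cutSq (c + r) w x (u + z) ∂ν := by
        congr 1
        refine integral_congr_ae (hae.mono fun u hu => ?_)
        have e : u + z - x = u + (z - x) := by abel
        -- The increments `u + z - x` are never cut off.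
        have hn : ‖u + z - x‖ ≤ c + r := by
          rw [e, add_comm c]
          exact (norm_add_le _ _).trans (add_le_add hu hz)
        simp only [cutSq, if_pos hn]
        rw [e, inner_add_right]
    _ = ∫ y, cutSq (c + r) w x y ∂(ENNReal.ofReal δ • ν.map (fun u => u + z)) := by
        rw [integral_smul_measure, ENNReal.toReal_ofReal hδ, smul_eq_mul,
          integral_map hsh.aemeasurable hcm.aestronglyMeasurable]
    _ ≤ ∫ y, cutSq (c + r) w x y ∂μ := by
        refine integral_mono_measure (smul_map_add_const_le h)
          (ae_of_all _ (cutSq_nonneg (c + r) w x)) ?_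
        refine Integrable.of_bound hcm.aestronglyMeasurable ((c + r) ^ 2)
          (ae_of_all _ fun y => ?_)
        rw [Real.norm_of_nonneg (cutSq_nonneg _ _ _ _)]
        exact cutSq_le_sq hw x y

/-- Under the uniform minorisation, bounded increments of the chain have, in each direction, a
second moment that is bounded away from zero uniformly in the current state. -/
theorem Model.UniformMinorisation.exists_le_integral_cutSq {A : Model d}
    (hmin : A.UniformMinorisation) :
    ∃ R : ℝ, 0 ≤ R ∧ ∀ w : Vec d, ‖w‖ = 1 → ∃ a : ℝ, 0 < a ∧
      ∀ (s : PDMat d) (x : Vec d), a ≤ ∫ y, cutSq R w x y ∂A.kernel s x := by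
  obtain ⟨ν, δ, c, ξ, hprob, ⟨K, hK, hνK⟩, hac, hδ, -, h⟩ := hmin
  obtain ⟨r, hr⟩ := hK.isBounded.exists_norm_le
  have hae : ∀ᵐ u ∂ν, ‖u‖ ≤ r := by
    have : ∀ᵐ u ∂ν, u ∈ K := by rw [ae_iff]; exact hνK
    exact this.mono hr
  obtain ⟨u0, hu0⟩ := hae.exists
  have hr0 : 0 ≤ r := (norm_nonneg _).trans hu0
  have hc0 : 0 ≤ c := (norm_nonneg _).trans (h 0 A.s₁).1
  refine ⟨c + r, add_nonneg hc0 hr0, fun w hw => ?_⟩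
  have hw0 : w ≠ 0 := fun h0 => by simp [h0] at hw
  have hmeas : Measurable fun u : Vec d => inner ℝ w u := measurable_id.const_inner
  have hL : MemLp (fun u => inner ℝ w u) 2 ν := by
    refine MemLp.of_bound hmeas.aestronglyMeasurable r (hae.mono fun u hu => ?_)
    refine (norm_inner_le_norm w u).trans ?_
    rwa [hw, one_mul]
  exact ⟨δ * ProbabilityTheory.variance (fun u => inner ℝ w u) ν,
    mul_pos hδ (variance_inner_pos hac hw0 hL), fun s x =>
      mul_variance_inner_le_integral_cutSq hδ.le hae hw (h x s).1 (h x s).2⟩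

end Increments

/-! ### The covariance recursion dominates running averages of squared increments -/

/-- Here `V` stands for `wᵀ S w`, `y` for the component of `X - M` in direction `w`, and `u` for
that of the increments of the chain. The functional `V n - η n / 2 * y n ^ 2` keeps half of the
last contribution in reserve, so that each step sees two consecutive values of `y`, from which `u`
is recovered by a difference. -/
theorem runningAverage_le_of_recursion {η g u V y : ℕ → ℝ} (hη : ∀ n, η n ∈ Set.Icc (0 : ℝ) 1)
    (hr : ∀ n, η (n + 1) / 2 ≤ (1 - η (n + 1)) * η n) (hV0 : η 0 * y 0 ^ 2 ≤ V 0)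
    (hV : ∀ n, V (n + 1) = (1 - η (n + 1)) * V n + η (n + 1) * y (n + 1) ^ 2)
    (hy : ∀ n, y (n + 1) = u n + (1 - η n) * y n) (hg : ∀ n, g n ≤ u n ^ 2) (n : ℕ) :
    runningAverage (fun k => η (k + 1)) g n ≤ 8 * (V n - η n / 2 * y n ^ 2) := by
  induction n with
  | zero =>
    have := mul_nonneg (hη 0).1 (sq_nonneg (y 0))
    simp only [runningAverage]
    linarith
  | succ n ih =>
    obtain ⟨h0, h1⟩ := hη n
    obtain ⟨h0', h1'⟩ := hη (n + 1)
    have hu : u n ^ 2 ≤ 2 * y (n + 1) ^ 2 + 2 * y n ^ 2 := by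
      have e : u n = y (n + 1) - (1 - η n) * y n := by rw [hy]; ring
      have h2 : ((1 - η n) * y n) ^ 2 ≤ y n ^ 2 := by
        rw [mul_pow]
        exact mul_le_of_le_one_left (sq_nonneg _)
          (pow_le_one₀ (sub_nonneg.2 h1) (by linarith))
      rw [e]
      nlinarith [sq_nonneg (y (n + 1) + (1 - η n) * y n)]
    have i1 := mul_le_mul_of_nonneg_left ih (sub_nonneg.2 h1')
    have i2 := mul_le_mul_of_nonneg_left ((hg n).trans hu) h0'
    have i3 := mul_le_mul_of_nonneg_right (hr n) (sq_nonneg (y n))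
    have i4 := mul_nonneg h0' (sq_nonneg (y (n + 1)))
    simp only [runningAverage]
    rw [hV]
    linarith

section Chain

variable {d : ℕ} {A : Model d} {Ω : Type*} {mΩ : MeasurableSpace Ω} {P : Measure Ω}
  {X M : ℕ → Ω → Vec d} {S : ℕ → Ω → PDMat d}

/-- The recursion for `S`, tested in direction `w`. -/
theorem IsProcess.dotProduct_step (hproc : IsProcess A P X M S) {n : ℕ} (hn : 1 ≤ n) (ω : Ω)
    (w : Vec d) :
    w.ofLp ⬝ᵥ ((S (n + 1) ω).1 *ᵥ w.ofLp)
      = (1 - A.η (n + 1)) * (w.ofLp ⬝ᵥ ((S n ω).1 *ᵥ w.ofLp))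
        + A.η (n + 1) * inner ℝ w (X (n + 1) ω - M n ω) ^ 2 := by
  have e : inner ℝ w (X (n + 1) ω - M n ω) = w.ofLp ⬝ᵥ (X (n + 1) ω - M n ω).ofLp := by
    rw [EuclideanSpace.inner_eq_star_dotProduct, dotProduct_comm]
    simp
  rw [hproc.step_S n hn ω, e, Matrix.add_mulVec, Matrix.smul_mulVec, Matrix.smul_mulVec,
    Matrix.vecMulVec_mulVec, dotProduct_add, dotProduct_smul, dotProduct_smul,
    op_smul_eq_smul, dotProduct_smul, dotProduct_comm _ w.ofLp]
  simp only [smul_eq_mul]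
  ring

/-- The increments of the chain are recovered from consecutive differences `X (n + 1) - M n`. -/
theorem IsProcess.inner_step (hproc : IsProcess A P X M S) {n : ℕ} (hn : 1 ≤ n) (ω : Ω)
    (w : Vec d) :
    inner ℝ w (X (n + 2) ω - M (n + 1) ω)
      = inner ℝ w (X (n + 2) ω - X (n + 1) ω)
        + (1 - A.η (n + 1)) * inner ℝ w (X (n + 1) ω - M n ω) := by
  rw [hproc.step_M n hn ω, ← real_inner_smul_right, ← inner_add_right]
  congr 1
  module

/-- The quadratic form of the covariance dominates the running averages of the cut-off squared
increments, which do not involve the means `M`. The hypothesis on the weights says that they do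
not increase by more than a factor of about two in one step. -/
theorem IsProcess.runningAverage_cutSq_le (hproc : IsProcess A P X M S) {K : ℕ} (hK : 1 ≤ K)
    (hr : ∀ n, K < n → A.η (n + 1) / 2 ≤ (1 - A.η (n + 1)) * A.η n) (R : ℝ) (w : Vec d) (ω : Ω)
    (n : ℕ) :
    runningAverage (fun k => A.η (K + k + 2))
        (fun k => cutSq R w (X (K + k + 1) ω) (X (K + k + 2) ω)) n
      ≤ 8 * (w.ofLp ⬝ᵥ ((S (K + n + 1) ω).1 *ᵥ w.ofLp)) := by
  have hη : ∀ n, A.η (K + n + 1) ∈ Set.Icc (0 : ℝ) 1 := fun n =>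
    Set.Ioo_subset_Icc_self (A.η_mem _ (by omega))
  have h := runningAverage_le_of_recursion
    (η := fun k => A.η (K + k + 1))
    (g := fun k => cutSq R w (X (K + k + 1) ω) (X (K + k + 2) ω))
    (u := fun k => inner ℝ w (X (K + k + 2) ω - X (K + k + 1) ω))
    (V := fun k => w.ofLp ⬝ᵥ ((S (K + k + 1) ω).1 *ᵥ w.ofLp))
    (y := fun k => inner ℝ w (X (K + k + 1) ω - M (K + k) ω))
    hη (fun k => hr (K + k + 1) (by omega)) ?_
    (fun k => hproc.dotProduct_step (n := K + k + 1) (by omega) ω w)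
    (fun k => hproc.inner_step (n := K + k) (by omega) ω w) (fun k => cutSq_le _ _ _ _) n
  · refine h.trans ?_
    have := mul_nonneg (hη n).1 (sq_nonneg (inner ℝ w (X (K + n + 1) ω - M (K + n) ω)))
    simp only
    linarith
  · have h1 := hproc.dotProduct_step hK ω w
    have h2 : 0 ≤ w.ofLp ⬝ᵥ ((S K ω).1 *ᵥ w.ofLp) := by
      simpa using (S K ω).2.posSemidef.dotProduct_mulVec_nonneg w.ofLp
    have h3 := mul_nonneg (sub_nonneg.2 (hη 0).2) h2
    simp only [add_zero] at h3 ⊢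
    linarith

theorem Model.RatioCondition.eventually_le (hratio : A.RatioCondition) :
    ∀ᶠ n in atTop, A.η (n + 1) / 2 ≤ (1 - A.η (n + 1)) * A.η n := by
  have h1 := hratio.eventually (gt_mem_nhds (show (1 : ℝ) < 3 / 2 by norm_num))
  have h2 := ((tendsto_add_atTop_iff_nat 1).2 A.η_tendsto).eventually
    (gt_mem_nhds (show (0 : ℝ) < 1 / 4 by norm_num))
  filter_upwards [h1, h2, eventually_ge_atTop 2] with n h1 h2 hn
  have h0 := (A.η_mem n hn).1
  rw [div_lt_iff₀ h0] at h1
  nlinarith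

/-! ### The history of the process -/

theorem IsProcess.history_le (hproc : IsProcess A P X M S) (n : ℕ) : history X M S n ≤ mΩ :=
  iSup₂_le fun k hk => ((hproc.measurable_X k hk.1).prodMk
    ((hproc.measurable_M k hk.1).prodMk (hproc.measurable_S k hk.1))).comap_le

theorem history_mono {n n' : ℕ} (h : n ≤ n') : history X M S n ≤ history X M S n' :=
  biSup_mono fun _ hk => ⟨hk.1, hk.2.trans h⟩

theorem measurable_history {k n : ℕ} (h1 : 1 ≤ k) (hk : k ≤ n) :
    Measurable[history X M S n] (X k) :=
  measurable_fst.comp (Measurable.mono (comap_measurable fun ω => (X k ω, M k ω, S k ω))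
    (le_biSup (fun k => MeasurableSpace.comap (fun ω => (X k ω, M k ω, S k ω)) inferInstance)
      (Set.mem_Icc.2 ⟨h1, hk⟩)) le_rfl)

/-- The history of the process from time `K` on, as a filtration. -/
def IsProcess.filtration (hproc : IsProcess A P X M S) (K : ℕ) : Filtration ℕ mΩ where
  seq n := history X M S (K + n)
  mono' _ _ h := history_mono (Nat.add_le_add_left h K)
  le' _ := hproc.history_le _

theorem IsProcess.le_condExp_cutSq [IsProbabilityMeasure P] (hproc : IsProcess A P X M S)
    {R a : ℝ} {w : Vec d} (hw : ‖w‖ = 1)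
    (ha : ∀ (s : PDMat d) (x : Vec d), a ≤ ∫ y, cutSq R w x y ∂A.kernel s x) {n : ℕ}
    (hn : 1 ≤ n) :
    ∀ᵐ ω ∂P, a ≤ (P[fun ω => cutSq R w (X n ω) (X (n + 1) ω) | history X M S n]) ω := by
  have hX := hproc.measurable_X n hn
  have hY := hproc.measurable_X (n + 1) (by omega)
  have hi : Integrable (fun ω => cutSq R w (X n ω) (X (n + 1) ω)) P := by
    refine Integrable.of_bound (measurable_cutSq_comp R w hX hY).aestronglyMeasurable
      (R ^ 2) (ae_of_all _ fun ω => ?_)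
    rw [Real.norm_of_nonneg (cutSq_nonneg _ _ _ _)]
    exact cutSq_le_sq hw _ _
  have h := condExp_eq_integral_of_transition (hproc.history_le n) hY
    (κ := fun ω => A.kernel (S n ω) (X n ω)) (hproc.step_X n hn) (measurable_history hn le_rfl)
    (f := fun p => cutSq R w p.1 p.2)
    (measurable_cutSq_comp R w measurable_fst measurable_snd) hi
  filter_upwards [h] with ω hω
  rw [hω]
  exact ha _ _

/-! ### Uniformity over directions -/

/-- The running averages of the truncated squared increments depend on the direction in a
uniformly Lipschitz way, so lower bounds for individual directions extend to the sphere by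
compactness. -/
theorem IsProcess.exists_le_runningAverage_cutSq [IsProbabilityMeasure P]
    (hproc : IsProcess A P X M S) (hell : A.EllCondition) {R : ℝ} (hR : 0 ≤ R)
    (hmin : ∀ w : Vec d, ‖w‖ = 1 → ∃ a : ℝ, 0 < a ∧
      ∀ (s : PDMat d) (x : Vec d), a ≤ ∫ y, cutSq R w x y ∂A.kernel s x) (K : ℕ) :
    ∃ c : ℝ, 0 < c ∧ ∀ᵐ ω ∂P, ∀ᶠ n in atTop, ∀ w ∈ Metric.sphere (0 : Vec d) 1,
      c ≤ runningAverage (fun k => A.η (K + k + 2))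
        (fun k => cutSq R w (X (K + k + 1) ω) (X (K + k + 2) ω)) n := by
  have hη : ∀ n, A.η (K + n + 2) ∈ Set.Icc (0 : ℝ) 1 := fun n =>
    Set.Ioo_subset_Icc_self (A.η_mem _ (by omega))
  have hη1 : ¬ Summable fun n => A.η (K + n + 2) := fun H =>
    hell.1 ((summable_nat_add_iff K).1 (by simpa only [add_comm K] using H))
  have hη2 : Summable fun n => A.η (K + n + 2) ^ 2 := by
    simpa only [add_comm K] using (summable_nat_add_iff K).2 hell.2
  refine (isCompact_sphere (0 : Vec d) 1).induction_on
    (p := fun s => ∃ c : ℝ, 0 < c ∧ ∀ᵐ ω ∂P, ∀ᶠ n in atTop, ∀ w ∈ s,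
      c ≤ runningAverage (fun k => A.η (K + k + 2))
        (fun k => cutSq R w (X (K + k + 1) ω) (X (K + k + 2) ω)) n) ?_ ?_ ?_ ?_
  · exact ⟨1, one_pos, by simp⟩
  · rintro s t hst ⟨c, hc, h⟩
    exact ⟨c, hc, h.mono fun ω hω => hω.mono fun n hn w hw => hn w (hst hw)⟩
  · rintro s t ⟨c, hc, h⟩ ⟨c', hc', h'⟩
    refine ⟨min c c', lt_min hc hc', ?_⟩
    filter_upwards [h, h'] with ω hω hω'
    filter_upwards [hω, hω'] with n hn hn' w hw
    exact hw.elim (fun hw => (min_le_left _ _).trans (hn w hw))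
      fun hw => (min_le_right _ _).trans (hn' w hw)
  · intro w hw
    rw [mem_sphere_zero_iff_norm] at hw
    obtain ⟨a, ha, hint⟩ := hmin w hw
    have hR1 : 0 < R ^ 2 + 1 := by positivity
    refine ⟨Metric.sphere 0 1 ∩ Metric.ball w (a / (8 * (R ^ 2 + 1))),
      inter_mem_nhdsWithin _ (Metric.ball_mem_nhds _ (by positivity)), a / 4, by positivity, ?_⟩
    have h := ae_eventually_lt_runningAverage (P := P) (hproc.filtration (K + 1))
      (g := fun k ω => cutSq R w (X (K + k + 1) ω) (X (K + k + 2) ω))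
      (η := fun k => A.η (K + k + 2)) (a := a) (b := a / 2) (B := R ^ 2)
      (fun n => (@measurable_cutSq_comp d Ω (history X M S (K + 1 + (n + 1))) R w _ _
        (measurable_history (by omega) (by omega))
        (measurable_history (by omega) (by omega))).stronglyMeasurable)
      (fun n ω => by
        rw [abs_of_nonneg (cutSq_nonneg _ _ _ _)]
        exact cutSq_le_sq hw _ _)
      hη hη1 hη2 (fun n => by
        change ∀ᵐ ω ∂P, a ≤ (P[fun ω => cutSq R w (X (K + n + 1) ω) (X (K + n + 2) ω) |
          history X M S (K + 1 + n)]) ω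
        rw [add_right_comm K 1 n]
        exact hproc.le_condExp_cutSq hw hint (n := K + n + 1) (by omega)) (by linarith)
    filter_upwards [h] with ω hω
    filter_upwards [hω] with n hn v hv
    have hv1 : ‖v‖ = 1 := mem_sphere_zero_iff_norm.1 hv.1
    have hC : 2 * R ^ 2 * ‖w - v‖ ≤ a / 4 := by
      have h2 : ‖w - v‖ < a / (8 * (R ^ 2 + 1)) := by
        rw [norm_sub_rev, ← dist_eq_norm]; exact hv.2
      rw [lt_div_iff₀ (by positivity)] at h2
      nlinarith [norm_nonneg (w - v)]
    have h3 := (abs_runningAverage_sub_le hη (by positivity)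
      (fun k => abs_cutSq_sub_le hR hw hv1 (X (K + k + 1) ω) (X (K + k + 2) ω)) n).trans hC
    have h4 := (abs_le.1 h3).2
    linarith

end Chain

end AdaptiveMetropolis

open AdaptiveMetropolis in
theorem mainTheorem4 {d : ℕ} (hd : 1 ≤ d) (A : Model d)
    (hmin : A.UniformMinorisation) (hratio : A.RatioCondition) (hell : A.EllCondition)
    {Ω : Type*} [MeasurableSpace Ω] (P : MeasureTheory.Measure Ω)
    [MeasureTheory.IsProbabilityMeasure P]
    (X M : ℕ → Ω → Vec d) (S : ℕ → Ω → PDMat d) (hproc : IsProcess A P X M S) :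
    ∀ᵐ ω ∂P, 0 < Filter.liminf (fun n => ((sphereInf (S n ω) : ℝ) : EReal)) Filter.atTop := by
  obtain ⟨R, hR, hint⟩ := hmin.exists_le_integral_cutSq
  obtain ⟨N, hN⟩ := eventually_atTop.1 hratio.eventually_le
  set K := N + 1 with hK
  obtain ⟨c, hc, h⟩ := hproc.exists_le_runningAverage_cutSq hell hR hint K
  have : Nonempty (Fin d) := ⟨⟨0, hd⟩⟩
  have : Nonempty (Metric.sphere (0 : Vec d) 1) :=
    (NormedSpace.sphere_nonempty.2 zero_le_one).to_subtype
  filter_upwards [h] with ω hω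
  have hev : ∀ᶠ n in atTop, ((c / 8 : ℝ) : EReal) ≤ ((sphereInf (S n ω) : ℝ) : EReal) := by
    obtain ⟨n₀, hn₀⟩ := eventually_atTop.1 hω
    refine eventually_atTop.2 ⟨K + n₀ + 1, fun n hn => ?_⟩
    obtain ⟨k, rfl⟩ : ∃ k, n = K + k + 1 := ⟨n - K - 1, by omega⟩
    refine EReal.coe_le_coe_iff.2 (le_ciInf fun w => ?_)
    have h1 := hn₀ k (by omega) w.1 w.2
    have h2 := hproc.runningAverage_cutSq_le (K := K) (by omega)
      (fun n hn => hN n (by omega)) R w.1 ω k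
    linarith
  exact (EReal.coe_pos.2 (by positivity)).trans_le (le_liminf_of_le (by isBoundedDefault) hev)
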